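/- **Setting.** Let $E$ be a Polish space and let $\Theta$ be a Polish space with metric $d_\Theta$. For $\theta\in\Theta$ let $K_\theta$ be a Markov transition kernel on $E$, with $(\theta,x)\mapsto K_\theta(x,A)$ measurable for every Borel set $A$. Assume that each $K_\theta$ is Feller (it maps bounded continuous functions to bounded continuous functions) and mixing: there are $0<\epsilon_\theta\le 1$ and a finite measure $\lambda_\theta$ on $E$ with $\epsilon_\theta\lambda_\theta(A)\le K_\theta(x,A)\le \epsilon_\theta^{-1}\lambda_\theta(A)$ for all $x\in E$ and all Borel $A\subseteq E$. Let $h:E\to\mathbb R^d$ be bounded and continuous and let $\sigma>0$. For an initial distribution $m$ on $E$ and $\theta\in\Theta$, let $\mathbb P_{m,\theta}$ (with expectation $\mathbb E_{m,\theta}$) be the law under which $X_0,X_1,\dots$ is a Markov chain with initial distribution $m$ and kernel $K_\theta$, and $Y_n=h(X_n)+V_n$ for $n\ge1$, where the $V_n$ are i.i.d. $N(0,\sigma^2 I)$ and independent of $X$. Let $Q^n_{m,\theta}$ be the law of $(Y_1,\dots,Y_n)$ under $\mathbb P_{m,\theta}$. Let $\mu_\theta$ be the limiting distribution of the chain with kernel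 $K_\theta$, and let $\nu_\theta=(\mu_\theta\circ h^{-1})*N(0,\sigma^2I)$ be the limiting distribution of the observations. Let $L_n(Y)=\frac1n\sum_{k=1}^n\delta_{Y_k}$. Write $\mathcal N_\rho(\alpha)$ for the open $d_\Theta$-ball of radius $\rho>0$ around $\alpha$, and $\mathcal B_r(\nu)$ for the open ball of radius $r$ around $\nu$ in the Lévy–Prohorov metric. For a probability measure $u$ on $\Theta$ (the prior), let $\tilde{\mathbb P}_{m,u}$ be the law under which $\theta\sim u$ and, given $\theta$, $(X,Y)$ has law $\mathbb P_{m,\theta}$. Then $\tilde{\mathbb P}_{m,u}(\theta\in\cdot\mid Y_n,\dots,Y_1)$ is the posterior distribution of the parameter. **Statement.** Let $\mu,\mu'$ be probability measures on $E$, let $u$ be a probability measure on $\Theta$, and let $\alpha\in\Theta$. Assume: 1. There are a sequence of positive numbers $\epsilon_n\downarrow0$ and a function $p:\mathbb N\to[1,\infty)$ with $p(n)/n\to0$ such that $$\limsup_{n\to\infty}\ \mathbb E_{\mu,\alpha}\left[\left(\frac{\sup_{\theta\in\mathcal N_{\epsilon_n}(\alpha)}\frac{dQ^n_{\mu,\alpha}}{dQ^n_{\mu',\theta}}(Y_1,\dots,Y_n)}{u(\mathcal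 N_{\epsilon_n}(\alpha))}\right)^{1/p(n)}\right]<\infty ,$$ for some choice of versions of the Radon–Nikodym derivatives that is jointly measurable in $\theta$ and the observations (for instance the ratio of the Lebesgue densities of $Q^n_{\mu,\alpha}$ and $Q^n_{\mu',\theta}$). 2. For every $\eta>0$ there are $r>0$ and $I_\eta>0$ such that $$\limsup_{n\to\infty}\frac1n\log\int_{\mathcal N_\eta(\alpha)^c}\mathbb P_{\mu',\theta}\big(L_n(Y)\in\mathcal B_r(\nu_\alpha)\big)\,u(d\theta)\le -I_\eta<0$$ (with $\log 0=-\infty$). Then, for every $\eta>0$, $$\lim_{n\to\infty}\mathbb E_{\mu,\alpha}\,\tilde{\mathbb P}_{\mu',u}\big(\theta\in\mathcal N_\eta(\alpha)^c\mid Y_n,\dots,Y_1\big)=0 .$$ -/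

import Mathlib

open MeasureTheory ProbabilityTheory Filter Topology Metric
open scoped ENNReal BoundedContinuousFunction

namespace HMM

variable {Θ E : Type*} [MeasurableSpace Θ] [MeasurableSpace E]

/-- The Feller property: the kernel maps bounded continuous functions to continuous functions
(which are then automatically bounded). -/
def IsFeller [TopologicalSpace E] (κ : Kernel E E) : Prop :=
  ∀ f : E →ᵇ ℝ, Continuous fun x => ∫ z, f z ∂(κ x)

/-- The mixing condition: `ε l(A) ≤ κ(x, A) ≤ ε⁻¹ l(A)` for all `x` and all measurable `A`, for
some constant `0 < ε ≤ 1` and some finite measure `l`. -/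
def IsMixing (κ : Kernel E E) : Prop :=
  ∃ ε : ℝ, 0 < ε ∧ ε ≤ 1 ∧ ∃ l : Measure E, IsFiniteMeasure l ∧
    ∀ (x : E) (A : Set E), MeasurableSet A →
      ENNReal.ofReal ε * l A ≤ κ x A ∧ κ x A ≤ ENNReal.ofReal (1 / ε) * l A

/-- `m` is the limiting distribution of the Markov chain with kernel `κ`: for every initial
distribution `m₀`, the law `m₀ κⁿ` of the chain at time `n` converges weakly to `m`. -/
def IsLimitingDistribution [TopologicalSpace E] (κ : Kernel E E) (m : Measure E) : Prop :=
  IsProbabilityMeasure m ∧ ∀ m₀ : Measure E, IsProbabilityMeasure m₀ → ∀ f : E →ᵇ ℝ,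
    Tendsto (fun n : ℕ => ∫ x, f x ∂((fun m' : Measure E => m'.bind κ)^[n] m₀)) atTop
      (𝓝 (∫ x, f x ∂m))

open Classical in
/-- The limiting distribution of the Markov chain with kernel `κ` (which exists and is unique
when `κ` is mixing; the value is `0` when there is none). -/
noncomputable def limitingDistribution [TopologicalSpace E] (κ : Kernel E E) : Measure E :=
  if H : ∃ m, IsLimitingDistribution κ m then H.choose else 0

lemma measurable_finCons (n : ℕ) :
    Measurable fun q : E × (Fin n → E) => (Fin.cons q.1 q.2 : Fin (n + 1) → E) := by
  refine measurable_pi_lambda _ fun i => ?_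
  refine Fin.cases ?_ (fun j => ?_) i
  · simpa using measurable_fst
  · simp only [Fin.cons_succ]
    fun_prop

/-- The law of `(X₁, …, Xₙ)` for the Markov chain with kernel `K_θ = K(θ, ·)` and `X₀ = x`, as a
kernel in `(θ, x)`: draw `X₁` from `K_θ(x, ·)`, then `(X₂, …, Xₙ)` from the same chain started at
`X₁`. That is, `K_θ(x, dx₁) K_θ(x₁, dx₂) ⋯ K_θ(xₙ₋₁, dxₙ)`. -/
noncomputable def signalFrom (K : Kernel (Θ × E) E) : (n : ℕ) → Kernel (Θ × E) (Fin n → E)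
  | 0 => Kernel.const _ (Measure.dirac Fin.elim0)
  | n + 1 =>
    (K ⊗ₖ (signalFrom K n).comap (fun q : (Θ × E) × E => (q.1.1, q.2))
      (by fun_prop)).map (fun q : E × (Fin n → E) => (Fin.cons q.1 q.2 : Fin (n + 1) → E))

instance (K : Kernel (Θ × E) E) [IsMarkovKernel K] (n : ℕ) : IsMarkovKernel (signalFrom K n) := by
  induction n with
  | zero => unfold signalFrom; infer_instance
  | succ n ih => unfold signalFrom; exact Kernel.IsMarkovKernel.map _ (measurable_finCons n)

/-- `P_{μ,θ}(dx₁, …, dxₙ)`: the law of `(X₁, …, Xₙ)` for the Markov chain with kernel `K_θ` and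
`X₀` distributed as `μ`, as a kernel in `θ`. -/
noncomputable def signalLaw (K : Kernel (Θ × E) E) (μ : Measure E) (n : ℕ) :
    Kernel Θ (Fin n → E) :=
  signalFrom K n ∘ₖ (Kernel.id ×ₖ Kernel.const Θ μ)

instance (K : Kernel (Θ × E) E) [IsMarkovKernel K] (μ : Measure E) [IsProbabilityMeasure μ]
    (n : ℕ) : IsMarkovKernel (signalLaw K μ n) := by
  unfold signalLaw; infer_instance

/-- The Gaussian law `N(0, σ² I)` on `ℝᵈ`. -/
noncomputable def noise (d : ℕ) (σ : ℝ) : Measure (EuclideanSpace ℝ (Fin d)) :=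
  (stdGaussian (EuclideanSpace ℝ (Fin d))).map fun z => σ • z

instance (d : ℕ) (σ : ℝ) : IsProbabilityMeasure (noise d σ) := by
  unfold noise
  exact Measure.isProbabilityMeasure_map (by fun_prop)

variable [TopologicalSpace E] [OpensMeasurableSpace E] {d : ℕ}

/-- The observations `Y_k = h(X_k) + V_k`, `k = 1, …, n`, as a function of the signal and the
noise. -/
noncomputable def observe (h : E →ᵇ EuclideanSpace ℝ (Fin d)) (n : ℕ)
    (q : (Fin n → E) × (Fin n → EuclideanSpace ℝ (Fin d))) (k : Fin n) :
    EuclideanSpace ℝ (Fin d) :=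
  h (q.1 k) + q.2 k

lemma measurable_observe (h : E →ᵇ EuclideanSpace ℝ (Fin d)) (n : ℕ) :
    Measurable (observe h n) := by
  refine measurable_pi_lambda _ fun k => ?_
  exact (h.continuous.measurable.comp ((measurable_pi_apply k).comp measurable_fst)).add
    ((measurable_pi_apply k).comp measurable_snd)

/-- `Qⁿ_{μ,θ}`: the law of `(Y₁, …, Yₙ)`, where `Y_k = h(X_k) + V_k`, `X` is the Markov chain with
kernel `K_θ` and initial distribution `μ`, and `V₁, …, Vₙ` are i.i.d. `N(0, σ² I)`, independent
of `X`; as a kernel in `θ`. -/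
noncomputable def obsLaw (K : Kernel (Θ × E) E) (h : E →ᵇ EuclideanSpace ℝ (Fin d)) (σ : ℝ)
    (μ : Measure E) (n : ℕ) : Kernel Θ (Fin n → EuclideanSpace ℝ (Fin d)) :=
  (signalLaw K μ n ×ₖ Kernel.const Θ (Measure.pi fun _ : Fin n => noise d σ)).map (observe h n)

instance (K : Kernel (Θ × E) E) [IsMarkovKernel K] (h : E →ᵇ EuclideanSpace ℝ (Fin d)) (σ : ℝ)
    (μ : Measure E) [IsProbabilityMeasure μ] (n : ℕ) : IsMarkovKernel (obsLaw K h σ μ n) := by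
  unfold obsLaw
  exact Kernel.IsMarkovKernel.map _ (measurable_observe h n)

/-- `ν_θ = (μ_θ ∘ h⁻¹) ∗ g`, the limiting distribution of the observations, for `κ = K_θ` with
limiting distribution `μ_θ`. -/
noncomputable def obsLimit (κ : Kernel E E) (h : E →ᵇ EuclideanSpace ℝ (Fin d)) (σ : ℝ) :
    Measure (EuclideanSpace ℝ (Fin d)) :=
  ((limitingDistribution κ).map h) ∗ noise d σ

/-- The empirical measure `n⁻¹ ∑ₖ δ_{yₖ}`. -/
noncomputable def empirical {n : ℕ} (y : Fin n → EuclideanSpace ℝ (Fin d)) :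
    Measure (EuclideanSpace ℝ (Fin d)) :=
  (n : ℝ≥0∞)⁻¹ • ∑ k, Measure.dirac (y k)

/-- The posterior distribution of the parameter given `(Y₁, …, Yₙ) = y`: the regular conditional
distribution of `θ` given the observations when `θ` has law `u` and, given `θ`, the observations
have law `Qⁿ_{μ,θ}`. -/
noncomputable def thetaPosterior [StandardBorelSpace Θ] [Nonempty Θ] (K : Kernel (Θ × E) E)
    [IsMarkovKernel K] (h : E →ᵇ EuclideanSpace ℝ (Fin d)) (σ : ℝ) (μ : Measure E)
    [IsProbabilityMeasure μ] (u : Measure Θ) [IsFiniteMeasure u] (n : ℕ) :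
    Kernel (Fin n → EuclideanSpace ℝ (Fin d)) Θ :=
  posterior (obsLaw K h σ μ n) u

end HMM

namespace HMM

/-! Write `Q` for the true law of the observations, `P θ` for the law under `θ` started from `μ'`,
and `N` for a small ball around `α`. The marginal law of the data under the prior dominates the
measure with `Q`-density `g = ∫_N ρ_θ⁻¹ du`. So a posterior mass averaged under `Q` can be
transferred to the marginal law at cost `t⁻¹` wherever `g ≥ t`, and Bayes' formula evaluates the
result. With `B` the complement of the `η`-ball and `G` an event of typical data,
`lintegral_posterior_le` gives `E_Q[posterior of B] ≤ Q(Gᶜ) + Q(g < t) + t⁻¹ ∫_B P θ (G) du`.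

Take `G` inside the event that the empirical measure is close to its limit under `α`, and `t =
exp(-nI/4)`. The last term is at most `exp(nI/4) exp(-nI/2)` by the exponential bound. Since `1/g ≤
sup_N ρ / u(N)`, Markov's inequality with exponent `1/p(n)` bounds the middle term by a constant
times `t^(1/p(n))`, which vanishes because `n/p(n) → ∞` (`measure_invLikelihood_lt_le`).

The first term vanishes by a weak law of large numbers (`tendsto_measure_levyProkhorovDist`). Mixing
makes the kernel contract oscillations, so centered additive functionals have variance of order `n`.
Chebyshev then gives convergence of the integral of each bounded continuous function, hence
convergence in the Lévy–Prokhorov metric. -/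

/-! ### Mutual absolute continuity of the noise and of the observation laws. -/

lemma pi_fin_absolutelyContinuous {X : Type*} [MeasurableSpace X] {μ ν : Measure X}
    [SigmaFinite μ] [SigmaFinite ν] (h : μ ≪ ν) (n : ℕ) :
    Measure.pi (fun _ : Fin n => μ) ≪ Measure.pi (fun _ : Fin n => ν) := by
  induction n with
  | zero => rw [Measure.pi_of_empty, Measure.pi_of_empty]
  | succ n ih =>
    have hμ := (measurePreserving_piFinSuccAbove (fun _ : Fin (n + 1) => μ) 0).symm.map_eq
    have hν := (measurePreserving_piFinSuccAbove (fun _ : Fin (n + 1) => ν) 0).symm.map_eq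
    rw [← hμ, ← hν]
    exact (h.prod ih).map (MeasurableEquiv.measurable _)

lemma stdGaussian_absolutelyContinuous (d : ℕ) :
    stdGaussian (EuclideanSpace ℝ (Fin d)) ≪ volume := by
  rw [← map_pi_eq_stdGaussian, ← (PiLp.volume_preserving_toLp (Fin d)).map_eq, volume_pi]
  exact (pi_fin_absolutelyContinuous (gaussianReal_absolutelyContinuous 0 one_ne_zero) d).map
    (by fun_prop)

lemma absolutelyContinuous_stdGaussian (d : ℕ) :
    volume ≪ stdGaussian (EuclideanSpace ℝ (Fin d)) := by
  rw [← map_pi_eq_stdGaussian, ← (PiLp.volume_preserving_toLp (Fin d)).map_eq, volume_pi]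
  exact (pi_fin_absolutelyContinuous (gaussianReal_absolutelyContinuous' 0 one_ne_zero) d).map
    (by fun_prop)

lemma noise_absolutelyContinuous (d : ℕ) {σ : ℝ} (hσ : σ ≠ 0) : noise d σ ≪ volume := by
  refine ((stdGaussian_absolutelyContinuous d).map (by fun_prop)).trans ?_
  rw [Measure.map_addHaar_smul _ hσ]
  exact Measure.smul_absolutelyContinuous

lemma absolutelyContinuous_noise (d : ℕ) {σ : ℝ} (hσ : σ ≠ 0) : volume ≪ noise d σ := by
  refine Measure.AbsolutelyContinuous.trans ?_ ((absolutelyContinuous_stdGaussian d).map (by fun_prop))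
  rw [Measure.map_addHaar_smul _ hσ]
  exact Measure.absolutelyContinuous_smul (by positivity)

section Observations

variable {Θ E : Type*} [MeasurableSpace Θ] [MeasurableSpace E]
  [TopologicalSpace E] [OpensMeasurableSpace E] {d : ℕ}

lemma obsLaw_apply (K : Kernel (Θ × E) E) [IsMarkovKernel K]
    (h : E →ᵇ EuclideanSpace ℝ (Fin d)) (σ : ℝ)
    (μ : Measure E) [IsProbabilityMeasure μ] (n : ℕ) (θ : Θ) :
    obsLaw K h σ μ n θ =
      ((signalLaw K μ n θ).prod (Measure.pi fun _ : Fin n => noise d σ)).map (observe h n) := by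
  rw [obsLaw, Kernel.map_apply _ (measurable_observe h n), Kernel.prod_apply, Kernel.const_apply]

/-- Mixtures of translates of the nondegenerate Gaussian noise are mutually absolutely
continuous. -/
lemma map_observe_absolutelyContinuous (h : E →ᵇ EuclideanSpace ℝ (Fin d)) {σ : ℝ} (hσ : σ ≠ 0)
    (n : ℕ) (S S' : Measure (Fin n → E)) [SFinite S] [IsProbabilityMeasure S'] :
    (S.prod (Measure.pi fun _ : Fin n => noise d σ)).map (observe h n) ≪
      (S'.prod (Measure.pi fun _ : Fin n => noise d σ)).map (observe h n) := by
  have hm := measurable_observe h n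
  refine Measure.AbsolutelyContinuous.mk fun A hA h0 => ?_
  rw [Measure.map_apply hm hA, Measure.prod_apply (hm hA)] at h0 ⊢
  have hsec : ∀ x : Fin n → E, Prod.mk x ⁻¹' (observe h n ⁻¹' A) =
      (fun v => (fun k => h (x k)) + v) ⁻¹' A := fun x => rfl
  -- A null set of the mixture is null for at least one translate of the noise. By translation
  -- invariance it is then Lebesgue null, hence null for every translate.
  have hvol : (Measure.pi fun _ : Fin n => (volume : Measure (EuclideanSpace ℝ (Fin d)))) A = 0 := by
    rw [lintegral_eq_zero_iff (measurable_measure_prodMk_left (hm hA))] at h0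
    obtain ⟨x, hx⟩ := h0.exists
    have hx := pi_fin_absolutelyContinuous (absolutelyContinuous_noise d hσ) n hx
    rwa [hsec, measure_preimage_add] at hx
  refine (lintegral_congr fun x => ?_).trans lintegral_zero
  refine pi_fin_absolutelyContinuous (noise_absolutelyContinuous d hσ) n ?_
  rwa [hsec, measure_preimage_add]

lemma obsLaw_absolutelyContinuous (K : Kernel (Θ × E) E) [IsMarkovKernel K]
    (h : E →ᵇ EuclideanSpace ℝ (Fin d)) {σ : ℝ} (hσ : σ ≠ 0)
    (μ μ' : Measure E) [IsProbabilityMeasure μ] [IsProbabilityMeasure μ'] (n : ℕ) (θ θ' : Θ) :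
    obsLaw K h σ μ n θ ≪ obsLaw K h σ μ' n θ' := by
  rw [obsLaw_apply, obsLaw_apply]
  exact map_observe_absolutelyContinuous h hσ n _ _

end Observations

/-! ### Posterior mass under the true law. -/

section Bayes

variable {T Y : Type*} [MeasurableSpace T] [MeasurableSpace Y]
  {P : Kernel T Y} [IsMarkovKernel P] {u : Measure T} [IsProbabilityMeasure u]
  {Q : Measure Y} [IsProbabilityMeasure Q] {ρ : T → Y → ℝ≥0∞} {N : Set T}

/-- The density of the part of the marginal law of the data coming from parameters in `N`, relative
to the true law, in terms of the likelihood ratios `ρ θ`. -/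
noncomputable def invLikelihood (u : Measure T) (ρ : T → Y → ℝ≥0∞) (N : Set T) (y : Y) : ℝ≥0∞ :=
  ∫⁻ θ in N, (ρ θ y)⁻¹ ∂u

lemma measurable_invLikelihood (hρ : Measurable (Function.uncurry ρ)) :
    Measurable (invLikelihood u ρ N) :=
  Measurable.lintegral_prod_left (f := fun θ y => (ρ θ y)⁻¹) hρ.inv

/-- Swap the integrals and change measure from `Q` to `P θ`. Equality may fail for two reasons: `ρ *
ρ⁻¹` is `0` where `ρ` is `0` or `∞`, and parameters outside `N` are discarded. -/
lemma lintegral_mul_invLikelihood_le (hρ : Measurable (Function.uncurry ρ))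
    (hac : ∀ θ, Q ≪ P θ) (hd : ∀ θ, ρ θ =ᵐ[P θ] Q.rnDeriv (P θ))
    {F : Y → ℝ≥0∞} (hF : Measurable F) :
    ∫⁻ y, F y * invLikelihood u ρ N y ∂Q ≤ ∫⁻ y, F y ∂(P ∘ₘ u) := by
  have hinv : Measurable (Function.uncurry fun θ y => (ρ θ y)⁻¹) := hρ.inv
  have hmeas : Measurable (Function.uncurry fun y θ => F y * (ρ θ y)⁻¹) :=
    (hF.comp measurable_fst).mul (hinv.comp measurable_swap)
  have hin : ∀ θ, Measurable (fun y => (ρ θ y)⁻¹) := fun θ => hinv.comp measurable_prodMk_left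
  calc ∫⁻ y, F y * invLikelihood u ρ N y ∂Q
      = ∫⁻ y, ∫⁻ θ in N, F y * (ρ θ y)⁻¹ ∂u ∂Q := by
        refine lintegral_congr fun y => ?_
        rw [invLikelihood, lintegral_const_mul]
        exact hinv.comp measurable_prodMk_right
    _ = ∫⁻ θ in N, ∫⁻ y, F y * (ρ θ y)⁻¹ ∂Q ∂u := lintegral_lintegral_swap hmeas.aemeasurable
    _ ≤ ∫⁻ θ in N, ∫⁻ y, F y ∂(P θ) ∂u := by
        refine lintegral_mono fun θ => ?_
        rw [← lintegral_rnDeriv_mul (f := fun y => F y * (ρ θ y)⁻¹) (hac θ)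
          (hF.mul (hin θ)).aemeasurable]
        refine lintegral_mono_ae ?_
        filter_upwards [hd θ] with y hy
        rw [← hy, mul_left_comm]
        exact mul_le_of_le_one_right' (ENNReal.mul_inv_le_one _)
    _ ≤ ∫⁻ θ, ∫⁻ y, F y ∂(P θ) ∂u := setLIntegral_le_lintegral _ _
    _ = ∫⁻ y, F y ∂(P ∘ₘ u) := (Measure.lintegral_bind P.aemeasurable hF.aemeasurable).symm

/-- Bound each `ρ θ y` in the integral by the supremum. Membership of `α` in `N` makes the supremum
nonzero `Q`-almost everywhere, which excludes the degenerate quotient `0 / 0 = 0`. -/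
lemma inv_invLikelihood_le (hac : ∀ θ, Q ≪ P θ) (hd : ∀ θ, ρ θ =ᵐ[P θ] Q.rnDeriv (P θ))
    (hN : MeasurableSet N) {α : T} (hα : α ∈ N) :
    ∀ᵐ y ∂Q, (invLikelihood u ρ N y)⁻¹ ≤ (⨆ θ ∈ N, ρ θ y) / u N := by
  filter_upwards [Measure.rnDeriv_pos (hac α), (hac α).ae_eq (hd α)] with y hpos hy
  set s := ⨆ θ ∈ N, ρ θ y with hs
  have hle : ∀ θ ∈ N, ρ θ y ≤ s := fun θ hθ => le_iSup₂ (f := fun θ _ => ρ θ y) θ hθ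
  have hs0 : s ≠ 0 := ((hy ▸ hpos).trans_le (hle α hα)).ne'
  have hg : s⁻¹ * u N ≤ invLikelihood u ρ N y := by
    rw [← setLIntegral_const]
    exact setLIntegral_mono' hN fun θ hθ => ENNReal.inv_le_inv.2 (hle θ hθ)
  refine (ENNReal.inv_le_inv.2 hg).trans_eq ?_
  rw [ENNReal.mul_inv (.inr (measure_ne_top _ _)) (.inl (by simpa using hs0)), inv_inv,
    div_eq_mul_inv]

/-- Markov's inequality for the (possibly non-measurable) supremum of the likelihood ratios. -/
lemma measure_invLikelihood_lt_le (hρ : Measurable (Function.uncurry ρ))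
    (hac : ∀ θ, Q ≪ P θ) (hd : ∀ θ, ρ θ =ᵐ[P θ] Q.rnDeriv (P θ))
    (hN : MeasurableSet N) {α : T} (hα : α ∈ N) {t : ℝ≥0∞} (ht0 : t ≠ 0) (htop : t ≠ ∞)
    {a : ℝ} (ha : 0 < a) :
    Q {y | invLikelihood u ρ N y < t} ≤
      t ^ a * ∫⁻ y, ((⨆ θ ∈ N, ρ θ y) / u N) ^ a ∂Q := by
  have hta : t ^ a ≠ 0 := by simp [ENNReal.rpow_eq_zero_iff, ht0, htop]
  have hta' : t ^ a ≠ ∞ := ENNReal.rpow_ne_top_of_nonneg ha.le htop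
  have hm : Measurable fun y => (invLikelihood u ρ N y)⁻¹ ^ a :=
    (measurable_invLikelihood hρ).inv.pow_const a
  calc Q {y | invLikelihood u ρ N y < t}
      ≤ Q {y | (t ^ a)⁻¹ ≤ (invLikelihood u ρ N y)⁻¹ ^ a} := by
        refine measure_mono fun y hy => ?_
        rw [Set.mem_ofPred_eq, ← ENNReal.inv_rpow]
        exact ENNReal.rpow_le_rpow (ENNReal.inv_le_inv.2 (le_of_lt hy)) ha.le
    -- Markov is applied to a measurable function; the supremum enters only afterwards, through
    -- monotonicity of the lower integral.
    _ ≤ (∫⁻ y, (invLikelihood u ρ N y)⁻¹ ^ a ∂Q) / (t ^ a)⁻¹ :=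
        meas_ge_le_lintegral_div hm.aemeasurable (by simpa using hta') (by simpa using hta)
    _ = t ^ a * ∫⁻ y, (invLikelihood u ρ N y)⁻¹ ^ a ∂Q := by
        rw [div_eq_mul_inv, inv_inv, mul_comm]
    _ ≤ _ := by
        refine mul_le_mul' le_rfl (lintegral_mono_ae ?_)
        filter_upwards [inv_invLikelihood_le (u := u) hac hd hN hα] with y hy
        exact ENNReal.rpow_le_rpow hy ha.le

/-- Both sides are the joint probability that the parameter is in `B` and the data in `G`. -/
lemma setLIntegral_posterior [StandardBorelSpace T] [Nonempty T] {G : Set Y} {B : Set T}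
    (hG : MeasurableSet G) (hB : MeasurableSet B) :
    ∫⁻ y in G, posterior P u y B ∂(P ∘ₘ u) = ∫⁻ θ in B, P θ G ∂u := by
  have h := DFunLike.congr_fun (compProd_posterior_eq_map_swap (κ := P) (μ := u)) (G ×ˢ B)
  rwa [Measure.compProd_apply_prod hG hB, Measure.map_apply measurable_swap (hG.prod hB),
    Set.preimage_swap_prod, Measure.compProd_apply_prod hB hG] at h

/-- The posterior is bounded by `1` on the two bad events. On the rest `1 ≤ t⁻¹ * invLikelihood`,
which turns the integral under `Q` into one under the marginal law. -/
lemma lintegral_posterior_le [StandardBorelSpace T] [Nonempty T]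
    (hρ : Measurable (Function.uncurry ρ))
    (hac : ∀ θ, Q ≪ P θ) (hd : ∀ θ, ρ θ =ᵐ[P θ] Q.rnDeriv (P θ))
    {G : Set Y} {B : Set T} (hG : MeasurableSet G) (hB : MeasurableSet B)
    {t : ℝ≥0∞} (ht0 : t ≠ 0) (htop : t ≠ ∞) :
    ∫⁻ y, posterior P u y B ∂Q ≤
      Q Gᶜ + Q {y | invLikelihood u ρ N y < t} + t⁻¹ * ∫⁻ θ in B, P θ G ∂u := by
  have hg := measurable_invLikelihood (u := u) (N := N) hρ
  have hL : MeasurableSet {y | invLikelihood u ρ N y < t} := measurableSet_lt hg measurable_const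
  have hpB : Measurable fun y => posterior P u y B := Kernel.measurable_coe _ hB
  calc ∫⁻ y, posterior P u y B ∂Q
      ≤ ∫⁻ y, (Gᶜ.indicator 1 y + {y | invLikelihood u ρ N y < t}.indicator 1 y +
          t⁻¹ * (G.indicator (fun y => posterior P u y B) y * invLikelihood u ρ N y)) ∂Q := by
        refine lintegral_mono fun y => ?_
        by_cases h1 : y ∈ G
        · by_cases h2 : invLikelihood u ρ N y < t
          · have : y ∈ {y | invLikelihood u ρ N y < t} := h2
            rw [Set.indicator_of_mem this]
            exact prob_le_one.trans (le_add_self.trans le_self_add)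
          · refine le_trans ?_ le_add_self
            rw [Set.indicator_of_mem h1, mul_left_comm]
            refine le_mul_of_one_le_right' ?_
            rw [← ENNReal.inv_mul_cancel ht0 htop]
            gcongr
            exact not_lt.1 h2
        · have : y ∈ Gᶜ := h1
          rw [Set.indicator_of_mem this, add_assoc]
          exact prob_le_one.trans le_self_add
    _ = Q Gᶜ + Q {y | invLikelihood u ρ N y < t} +
          t⁻¹ * ∫⁻ y, G.indicator (fun y => posterior P u y B) y * invLikelihood u ρ N y ∂Q := by
        rw [lintegral_add_left, lintegral_add_left, lintegral_const_mul,
          lintegral_indicator_one hG.compl, lintegral_indicator_one hL]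
        · exact (hpB.indicator hG).mul hg
        · exact measurable_one.indicator hG.compl
        · exact (measurable_one.indicator hG.compl).add (measurable_one.indicator hL)
    _ ≤ _ := by
        gcongr
        refine (lintegral_mul_invLikelihood_le hρ hac hd (hpB.indicator hG)).trans_eq ?_
        rw [lintegral_indicator hG, setLIntegral_posterior hG hB]

end Bayes

/-! ### Ergodicity of mixing kernels. -/

section Mixing

variable {E : Type*} [MeasurableSpace E]

/-- The action of a kernel on functions. -/
noncomputable def act (κ : Kernel E E) (f : E → ℝ) (x : E) : ℝ := ∫ z, f z ∂(κ x)

lemma measurable_act {κ : Kernel E E} {f : E → ℝ} (hf : Measurable f) : Measurable (act κ f) :=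
  hf.stronglyMeasurable.integral_kernel.measurable

lemma measurable_act_iterate {κ : Kernel E E} {f : E → ℝ} (hf : Measurable f) (n : ℕ) :
    Measurable ((act κ)^[n] f) := by
  induction n with
  | zero => exact hf
  | succ n ih => rw [Function.iterate_succ_apply']; exact measurable_act ih

lemma integrable_of_mem_Icc {X : Type*} [MeasurableSpace X] {m : Measure X} [IsFiniteMeasure m]
    {f : X → ℝ} (hf : Measurable f) {a b : ℝ} (h : ∀ x, f x ∈ Set.Icc a b) : Integrable f m :=
  .of_mem_Icc a b hf.aemeasurable (.of_forall h)

lemma act_mem_Icc {κ : Kernel E E} [IsMarkovKernel κ] {f : E → ℝ} (hf : Measurable f) {a b : ℝ}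
    (h : ∀ x, f x ∈ Set.Icc a b) (x : E) : act κ f x ∈ Set.Icc a b := by
  have hi : Integrable f (κ x) := integrable_of_mem_Icc hf h
  constructor
  · simpa [act] using integral_mono (integrable_const a) hi fun y => (h y).1
  · simpa [act] using integral_mono hi (integrable_const b) fun y => (h y).2

lemma act_iterate_mem_Icc {κ : Kernel E E} [IsMarkovKernel κ] {f : E → ℝ} (hf : Measurable f)
    {a b : ℝ} (h : ∀ x, f x ∈ Set.Icc a b) (n : ℕ) (x : E) : (act κ)^[n] f x ∈ Set.Icc a b := by
  induction n generalizing x with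
  | zero => exact h x
  | succ n ih =>
    rw [Function.iterate_succ_apply']
    exact act_mem_Icc (measurable_act_iterate hf n) ih x

/-- A mixing kernel contracts oscillations by a fixed factor. -/
lemma IsMixing.exists_contraction [Nonempty E] {κ : Kernel E E} [IsMarkovKernel κ]
    (hκ : IsMixing κ) : ∃ β : ℝ, 0 ≤ β ∧ β < 1 ∧ ∀ f : E → ℝ, Measurable f → ∀ a w : ℝ,
      (∀ x, f x ∈ Set.Icc a (a + w)) → ∃ a', ∀ x, act κ f x ∈ Set.Icc a' (a' + β * w) := by
  obtain ⟨ε, hε0, -, l, hl, hmix⟩ := hκ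
  obtain ⟨x₀⟩ := ‹Nonempty E›
  -- Doeblin minorization: `τ` is a part common to all `κ x`, so only the remaining mass `1 - τ(E)`
  -- can separate the values of `act κ f`.
  set τ : Measure E := ENNReal.ofReal ε • l with hτ
  have hfin : IsFiniteMeasure τ := l.smul_finite ENNReal.ofReal_ne_top
  have hle : ∀ x, τ ≤ κ x := fun x =>
    Measure.le_iff.2 fun A hA => by simpa [hτ] using (hmix x A hA).1
  -- The upper mixing bound would otherwise give `κ x₀` total mass zero.
  have hpos : τ Set.univ ≠ 0 := by
    intro h0
    have h1 := (hmix x₀ Set.univ .univ).2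
    have h2 : l Set.univ = 0 := by simpa [hτ, hε0.not_ge] using h0
    rw [h2] at h1
    simp at h1
  set t := τ.real Set.univ with ht
  have ht0 : 0 < t := ENNReal.toReal_pos hpos (measure_ne_top _ _)
  have ht1 : t ≤ 1 := by
    refine (ENNReal.toReal_mono (measure_ne_top _ _) (hle x₀ Set.univ)).trans ?_
    simp
  refine ⟨1 - t, by linarith, by linarith, fun f hf a w h => ⟨a + ∫ z, (f z - a) ∂τ, fun x => ?_⟩⟩
  have hi : ∀ (m : Measure E) [IsFiniteMeasure m], Integrable f m :=
    fun m _ => integrable_of_mem_Icc hf h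
  have h1 : ∫ z, (f z - a) ∂τ ≤ ∫ z, (f z - a) ∂(κ x) :=
    integral_mono_measure (hle x) (.of_forall fun z => sub_nonneg.2 (h z).1)
      ((hi _).sub (integrable_const _))
  have h2 : ∫ z, (a + w - f z) ∂τ ≤ ∫ z, (a + w - f z) ∂(κ x) :=
    integral_mono_measure (hle x) (.of_forall fun z => sub_nonneg.2 (h z).2)
      ((integrable_const _).sub (hi _))
  rw [integral_sub (integrable_const _) (hi _), integral_sub (integrable_const _) (hi _)] at h2
  rw [integral_sub (hi _) (integrable_const _), integral_sub (hi _) (integrable_const _)] at h1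
  rw [integral_sub (hi _) (integrable_const _)]
  simp only [integral_const, probReal_univ, smul_eq_mul, one_mul, ← ht] at h1 h2 ⊢
  constructor <;> simp only [act] <;> linarith

/-- Geometric convergence of the iterates of a mixing kernel. -/
lemma IsMixing.exists_geometric [Nonempty E] {κ : Kernel E E} [IsMarkovKernel κ]
    (hκ : IsMixing κ) : ∃ β : ℝ, 0 ≤ β ∧ β < 1 ∧ ∀ f : E → ℝ, Measurable f → ∀ C : ℝ,
      (∀ x, |f x| ≤ C) → ∃ c, ∀ n x, |(act κ)^[n] f x - c| ≤ β ^ n * (2 * C) := by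
  obtain ⟨β, hβ0, hβ1, hβ⟩ := hκ.exists_contraction
  obtain ⟨x₀⟩ := ‹Nonempty E›
  refine ⟨β, hβ0, hβ1, fun f hf C hC => ?_⟩
  have hosc : ∀ n, ∃ a, ∀ x, (act κ)^[n] f x ∈ Set.Icc a (a + β ^ n * (2 * C)) := by
    intro n
    induction n with
    | zero =>
      refine ⟨-C, fun x => ?_⟩
      have := abs_le.1 (hC x)
      simp only [Function.iterate_zero, id, pow_zero, Set.mem_Icc]
      constructor <;> linarith
    | succ n ih =>
      obtain ⟨a, ha⟩ := ih
      obtain ⟨a', ha'⟩ := hβ _ (measurable_act_iterate hf n) a _ ha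
      refine ⟨a', fun x => ?_⟩
      rw [Function.iterate_succ_apply', pow_succ', mul_assoc]
      exact ha' x
  choose a ha using hosc
  -- A Markov operator preserves bounds, so all later iterates stay in the `n`-th interval. The
  -- limit along `x₀` then lies in every interval and serves for all `x`.
  have hmem : ∀ n k x, (act κ)^[n + k] f x ∈ Set.Icc (a n) (a n + β ^ n * (2 * C)) := by
    intro n k x
    rw [Nat.add_comm, Function.iterate_add_apply]
    exact act_iterate_mem_Icc (κ := κ) (measurable_act_iterate hf n) (ha n) k x
  have hdist : ∀ n, dist ((act κ)^[n] f x₀) ((act κ)^[n + 1] f x₀) ≤ 2 * C * β ^ n := by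
    intro n
    rw [mul_comm, Real.dist_eq]
    exact (Real.dist_le_of_mem_Icc (hmem n 0 x₀) (hmem n 1 x₀)).trans_eq (by ring)
  obtain ⟨c, hc⟩ := cauchySeq_tendsto_of_complete (cauchySeq_of_le_geometric β _ hβ1 hdist)
  refine ⟨c, fun n x => ?_⟩
  have hcn : c ∈ Set.Icc (a n) (a n + β ^ n * (2 * C)) := by
    refine isClosed_Icc.mem_of_tendsto hc (eventually_atTop.2 ⟨n, fun k hk => ?_⟩)
    obtain ⟨j, rfl⟩ := Nat.exists_eq_add_of_le hk
    exact hmem n j x₀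
  exact (Real.dist_le_of_mem_Icc (hmem n 0 x) hcn).trans_eq (by ring)

lemma isProbabilityMeasure_bind_iterate (κ : Kernel E E) [IsMarkovKernel κ] (n : ℕ)
    (m : Measure E) [IsProbabilityMeasure m] :
    IsProbabilityMeasure ((fun m' : Measure E => m'.bind κ)^[n] m) := by
  induction n with
  | zero => assumption
  | succ n ih => rw [Function.iterate_succ_apply']; infer_instance

lemma integral_bind {X Y : Type*} [MeasurableSpace X] [MeasurableSpace Y] (κ : Kernel X Y)
    {m : Measure X} {f : Y → ℝ} (hf : Integrable f (m.bind κ)) :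
    ∫ y, f y ∂(m.bind κ) = ∫ x, ∫ y, f y ∂(κ x) ∂m := by
  have h := Kernel.integral_comp (η := κ) (κ := Kernel.const Unit m) (a := ()) (f := f)
  rw [Kernel.comp_apply, Kernel.const_apply] at h
  exact h hf

lemma integral_bind_iterate (κ : Kernel E E) [IsMarkovKernel κ] {f : E → ℝ} (hf : Measurable f)
    {C : ℝ} (hC : ∀ x, |f x| ≤ C) (n : ℕ) (m : Measure E) [IsProbabilityMeasure m] :
    ∫ x, f x ∂((fun m' : Measure E => m'.bind κ)^[n] m) = ∫ x, (act κ)^[n] f x ∂m := by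
  induction n generalizing m with
  | zero => rfl
  | succ n ih =>
    rw [Function.iterate_succ_apply, ih, Function.iterate_succ_apply']
    exact integral_bind κ (integrable_of_mem_Icc (measurable_act_iterate hf n)
      (act_iterate_mem_Icc hf (fun x => abs_le.1 (hC x)) n))

lemma tendsto_integral_bind_iterate (κ : Kernel E E) [IsMarkovKernel κ] {f : E → ℝ}
    (hf : Measurable f) {C : ℝ} (hC : ∀ x, |f x| ≤ C) {β c : ℝ} (hβ0 : 0 ≤ β) (hβ1 : β < 1)
    (hc : ∀ n x, |(act κ)^[n] f x - c| ≤ β ^ n * (2 * C))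
    (m : Measure E) [IsProbabilityMeasure m] :
    Tendsto (fun n => ∫ x, f x ∂((fun m' : Measure E => m'.bind κ)^[n] m)) atTop (𝓝 c) := by
  have h0 : Tendsto (fun n : ℕ => β ^ n * (2 * C)) atTop (𝓝 0) := by
    simpa using (tendsto_pow_atTop_nhds_zero_of_lt_one hβ0 hβ1).mul_const (2 * C)
  refine tendsto_iff_dist_tendsto_zero.2 (squeeze_zero (fun _ => dist_nonneg) (fun n => ?_) h0)
  rw [integral_bind_iterate κ hf hC, Real.dist_eq]
  have hi : Integrable ((act κ)^[n] f) m := integrable_of_mem_Icc (measurable_act_iterate hf n)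
      (act_iterate_mem_Icc hf (fun x => abs_le.1 (hC x)) n)
  have h1 : ∫ x, (act κ)^[n] f x ∂m - c = ∫ x, ((act κ)^[n] f x - c) ∂m := by
    rw [integral_sub hi (integrable_const _)]; simp
  rw [h1]
  simpa using norm_integral_le_of_norm_le_const (μ := m) (f := fun x => (act κ)^[n] f x - c)
    (.of_forall (hc n))

variable [TopologicalSpace E] [PolishSpace E] [BorelSpace E]

/-- Geometric contraction gives limits of all integrals, independent of the initial law. That these
limits come from a measure follows from Prokhorov: the laws are dominated by one finite measure,
hence tight. -/
lemma IsMixing.exists_isLimitingDistribution [Nonempty E] {κ : Kernel E E} [IsMarkovKernel κ]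
    (hκ : IsMixing κ) : ∃ m, IsLimitingDistribution κ m := by
  obtain ⟨β, hβ0, hβ1, hgeo⟩ := hκ.exists_geometric
  obtain ⟨ε, hε0, -, l, hl, hmix⟩ := hκ
  obtain ⟨x₀⟩ := ‹Nonempty E›
  have hlim : ∀ f : E →ᵇ ℝ, ∃ c, ∀ (m : Measure E) [IsProbabilityMeasure m],
      Tendsto (fun n => ∫ x, f x ∂((fun m' : Measure E => m'.bind κ)^[n] m)) atTop (𝓝 c) := by
    intro f
    have hC : ∀ x, |f x| ≤ ‖f‖ := f.norm_coe_le_norm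
    obtain ⟨c, hc⟩ := hgeo f f.continuous.measurable _ hC
    exact ⟨c, fun m _ => tendsto_integral_bind_iterate κ f.continuous.measurable hC hβ0 hβ1 hc m⟩
  -- The sequence starts at time `1`: the domination by `ε⁻¹ l` requires at least one transition.
  set ν : ℕ → ProbabilityMeasure E := fun n =>
    ⟨(fun m' : Measure E => m'.bind κ)^[n + 1] (Measure.dirac x₀),
      isProbabilityMeasure_bind_iterate κ _ _⟩ with hν
  have hdom : ∀ n, (ν n : Measure E) ≤ ENNReal.ofReal (1 / ε) • l := by
    intro n
    refine Measure.le_iff.2 fun A hA => ?_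
    have := isProbabilityMeasure_bind_iterate κ n (Measure.dirac x₀)
    simp only [hν, ProbabilityMeasure.coe_mk, Function.iterate_succ_apply']
    rw [Measure.bind_apply hA κ.aemeasurable]
    refine (lintegral_mono fun x => (hmix x A hA).2).trans ?_
    simp
  have htight : IsTightMeasureSet {((m : ProbabilityMeasure E) : Measure E) | m ∈ Set.range ν} := by
    have := l.smul_finite (c := ENNReal.ofReal (1 / ε)) ENNReal.ofReal_ne_top
    rw [isTightMeasureSet_iff_exists_isCompact_measure_compl_le]
    intro δ hδ
    obtain ⟨A, hA, hAδ⟩ := isTightMeasureSet_iff_exists_isCompact_measure_compl_le.1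
      (isTightMeasureSet_singleton (μ := ENNReal.ofReal (1 / ε) • l)) δ hδ
    refine ⟨A, hA, ?_⟩
    rintro _ ⟨_, ⟨n, rfl⟩, rfl⟩
    exact (hdom n _).trans (hAδ _ rfl)
  obtain ⟨m, -, φ, hφ, hm⟩ := (isCompact_closure_of_isTightMeasureSet htight).tendsto_subseq
    fun n => subset_closure ⟨n, rfl⟩
  refine ⟨m, inferInstance, fun m₀ _ f => ?_⟩
  obtain ⟨c, hc⟩ := hlim f
  have h1 := ProbabilityMeasure.tendsto_iff_forall_integral_tendsto.1 hm f
  have h2 := ((tendsto_add_atTop_iff_nat 1).2 (hc (Measure.dirac x₀))).comp hφ.tendsto_atTop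
  rw [tendsto_nhds_unique h1 h2]
  exact hc m₀

lemma IsMixing.isLimitingDistribution [Nonempty E] {κ : Kernel E E} [IsMarkovKernel κ]
    (hκ : IsMixing κ) : IsLimitingDistribution κ (limitingDistribution κ) := by
  have H := hκ.exists_isLimitingDistribution
  rw [limitingDistribution, dif_pos H]
  exact H.choose_spec

/-- Functions that are centered for the limiting distribution have uniformly bounded sums of
iterates. -/
lemma IsMixing.exists_sum_act_le [Nonempty E] {κ : Kernel E E} [IsMarkovKernel κ]
    (hκ : IsMixing κ) (ψ : E →ᵇ ℝ) (hψ : ∫ x, ψ x ∂(limitingDistribution κ) = 0) :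
    ∃ D, ∀ n x, |∑ k ∈ Finset.range n, (act κ)^[k + 1] ψ x| ≤ D := by
  have hlim := hκ.isLimitingDistribution
  obtain ⟨β, hβ0, hβ1, hgeo⟩ := hκ.exists_geometric
  have hC : ∀ x, |ψ x| ≤ ‖ψ‖ := ψ.norm_coe_le_norm
  obtain ⟨c, hc⟩ := hgeo ψ ψ.continuous.measurable _ hC
  obtain ⟨x₀⟩ := ‹Nonempty E›
  have hc0 : c = 0 := by
    rw [← hψ]
    exact tendsto_nhds_unique
      (tendsto_integral_bind_iterate κ ψ.continuous.measurable hC hβ0 hβ1 hc (Measure.dirac x₀))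
      (hlim.2 _ inferInstance ψ)
  subst hc0
  refine ⟨(1 - β)⁻¹ * (2 * ‖ψ‖), fun n x => ?_⟩
  calc |∑ k ∈ Finset.range n, (act κ)^[k + 1] ψ x|
      ≤ ∑ k ∈ Finset.range n, |(act κ)^[k + 1] ψ x| := Finset.abs_sum_le_sum_abs _ _
    _ ≤ ∑ k ∈ Finset.range n, β ^ k * (2 * ‖ψ‖) := by
        gcongr with k
        refine (by simpa using hc (k + 1) x : _ ≤ _).trans ?_
        exact mul_le_mul_of_nonneg_right (pow_le_pow_of_le_one hβ0 hβ1.le k.le_succ) (by positivity)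
    _ = (∑ k ∈ Finset.range n, β ^ k) * (2 * ‖ψ‖) := by rw [Finset.sum_mul]
    _ ≤ _ := by
        gcongr
        rw [← tsum_geometric_of_lt_one hβ0 hβ1]
        exact (summable_geometric_of_lt_one hβ0 hβ1).sum_le_tsum _ fun k _ => pow_nonneg hβ0 k

end Mixing

/-! ### Moments of additive functionals of the signal. -/

section Signal

variable {Θ E : Type*} [MeasurableSpace Θ] [MeasurableSpace E]

lemma integral_signalFrom_succ (K : Kernel (Θ × E) E) [IsMarkovKernel K] (θ : Θ) (n : ℕ) (x : E)
    {G : (Fin (n + 1) → E) → ℝ} (hG : Measurable G) {C : ℝ} (hC : ∀ z, |G z| ≤ C) :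
    ∫ z, G z ∂(signalFrom K (n + 1) (θ, x)) =
      ∫ x₁, ∫ z, G (Fin.cons x₁ z) ∂(signalFrom K n (θ, x₁)) ∂(K.sectR θ x) := by
  have hm := measurable_finCons (E := E) n
  rw [signalFrom, Kernel.map_apply _ hm, integral_map hm.aemeasurable hG.aestronglyMeasurable,
    ProbabilityTheory.integral_compProd]
  · rfl
  · exact integrable_of_mem_Icc (hG.comp hm) fun z => abs_le.1 (hC _)

lemma abs_sum_le_card_mul {X : Type*} {ψ : X → ℝ} {C : ℝ} (hC : ∀ x, |ψ x| ≤ C) {n : ℕ}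
    (z : Fin n → X) : |∑ k, ψ (z k)| ≤ n * C := by
  refine (Finset.abs_sum_le_sum_abs _ _).trans ((Finset.sum_le_sum fun k _ => hC (z k)).trans_eq ?_)
  simp

lemma integral_sum_signalFrom (K : Kernel (Θ × E) E) [IsMarkovKernel K] (θ : Θ)
    {ψ : E → ℝ} (hψ : Measurable ψ) {C : ℝ} (hC : ∀ x, |ψ x| ≤ C) (n : ℕ) (x : E) :
    ∫ z, ∑ k, ψ (z k) ∂(signalFrom K n (θ, x)) =
      ∑ k ∈ Finset.range n, (act (K.sectR θ))^[k + 1] ψ x := by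
  induction n generalizing x with
  | zero => simp
  | succ n ih =>
    have hbd := fun k => act_iterate_mem_Icc (κ := K.sectR θ) hψ (fun x => abs_le.1 (hC x)) k
    have hint : ∀ k, Integrable ((act (K.sectR θ))^[k] ψ) (K.sectR θ x) := fun k =>
      integrable_of_mem_Icc (measurable_act_iterate hψ k) (hbd k)
    have hsum : ∀ x₁, ∫ z : Fin n → E, ∑ k, ψ ((Fin.cons x₁ z : Fin (n + 1) → E) k)
        ∂(signalFrom K n (θ, x₁)) = ∑ k ∈ Finset.range (n + 1), (act (K.sectR θ))^[k] ψ x₁ := by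
      intro x₁
      simp only [Fin.sum_univ_succ, Fin.cons_zero, Fin.cons_succ]
      rw [integral_add (integrable_const _), ih, Finset.sum_range_succ']
      · simp [add_comm]
      · exact integrable_of_mem_Icc (by fun_prop) fun z => abs_le.1 (abs_sum_le_card_mul hC z)
    rw [integral_signalFrom_succ K θ n x (by fun_prop) (abs_sum_le_card_mul hC)]
    simp_rw [hsum]
    rw [integral_finsetSum _ fun k _ => hint k]
    exact Finset.sum_congr rfl fun k _ => by rw [Function.iterate_succ_apply', act]

lemma abs_sq_sum_le {X : Type*} {ψ : X → ℝ} {C : ℝ} (hC : ∀ x, |ψ x| ≤ C) {n : ℕ}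
    (z : Fin n → X) : |(∑ k, ψ (z k)) ^ 2| ≤ (n * C) ^ 2 := by
  rw [abs_pow]
  exact pow_le_pow_left₀ (abs_nonneg _) (abs_sum_le_card_mul hC z) 2

/-- The second moment of the sums of a function along the chain grows at most linearly, when the
first moments are bounded. -/
lemma integral_sq_sum_signalFrom_le (K : Kernel (Θ × E) E) [IsMarkovKernel K] (θ : Θ)
    {ψ : E → ℝ} (hψ : Measurable ψ) {C D : ℝ} (hC : ∀ x, |ψ x| ≤ C)
    (hD : ∀ n x, |∑ k ∈ Finset.range n, (act (K.sectR θ))^[k + 1] ψ x| ≤ D) (n : ℕ) (x : E) :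
    ∫ z, (∑ k, ψ (z k)) ^ 2 ∂(signalFrom K n (θ, x)) ≤ n * (C ^ 2 + 2 * C * D) := by
  induction n generalizing x with
  | zero => simp
  | succ n ih =>
    have hC0 : 0 ≤ C := (abs_nonneg _).trans (hC x)
    rw [integral_signalFrom_succ K θ n x (by fun_prop) (abs_sq_sum_le hC)]
    have hone : ∀ x₁, ∫ z : Fin n → E, (∑ k, ψ ((Fin.cons x₁ z : Fin (n + 1) → E) k)) ^ 2
        ∂(signalFrom K n (θ, x₁)) ≤ (n + 1 : ℕ) * (C ^ 2 + 2 * C * D) := by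
      intro x₁
      have hi1 : Integrable (fun z : Fin n → E => ∑ k, ψ (z k)) (signalFrom K n (θ, x₁)) :=
        integrable_of_mem_Icc (by fun_prop) fun z => abs_le.1 (abs_sum_le_card_mul hC z)
      have hi2 : Integrable (fun z : Fin n → E => (∑ k, ψ (z k)) ^ 2) (signalFrom K n (θ, x₁)) :=
        integrable_of_mem_Icc (by fun_prop) fun z => abs_le.1 (abs_sq_sum_le hC z)
      -- Given the first state, the remaining sum has mean at most `D` in absolute value. Hence the
      -- square and the cross term together add at most `C² + 2CD` per step.
      have hexp : ∀ z : Fin n → E, (∑ k, ψ ((Fin.cons x₁ z : Fin (n + 1) → E) k)) ^ 2 =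
          ψ x₁ ^ 2 + 2 * ψ x₁ * (∑ k, ψ (z k)) + (∑ k, ψ (z k)) ^ 2 := by
        intro z
        simp only [Fin.sum_univ_succ, Fin.cons_zero, Fin.cons_succ]
        ring
      simp_rw [hexp]
      have hi3 : Integrable (fun z : Fin n → E => ψ x₁ ^ 2 + 2 * ψ x₁ * ∑ k, ψ (z k))
          (signalFrom K n (θ, x₁)) := (integrable_const _).add (hi1.const_mul _)
      rw [integral_add hi3 hi2, integral_add (integrable_const _) (hi1.const_mul _), integral_const_mul,
        integral_sum_signalFrom K θ hψ hC]
      have h1 : ψ x₁ ^ 2 ≤ C ^ 2 := sq_le_sq' (abs_le.1 (hC x₁)).1 (abs_le.1 (hC x₁)).2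
      have h2 : ψ x₁ * ∑ k ∈ Finset.range n, (act (K.sectR θ))^[k + 1] ψ x₁ ≤ C * D := by
        refine (le_abs_self _).trans ?_
        rw [abs_mul]
        exact mul_le_mul (hC x₁) (hD n x₁) (abs_nonneg _) hC0
      have h3 := ih x₁
      simp only [integral_const, probReal_univ, one_smul]
      push_cast
      linarith
    refine (integral_mono_of_nonneg (.of_forall fun x₁ => integral_nonneg fun z => sq_nonneg _)
      (integrable_const _) (.of_forall hone)).trans_eq ?_
    simp

lemma signalLaw_apply (K : Kernel (Θ × E) E) [IsMarkovKernel K] (μ : Measure E)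
    [IsProbabilityMeasure μ] (n : ℕ) (θ : Θ) :
    signalLaw K μ n θ = μ.bind ((signalFrom K n).sectR θ) := by
  ext A hA
  have hmA := Kernel.measurable_coe (signalFrom K n) hA
  rw [signalLaw, Kernel.comp_apply, Kernel.prod_apply, Kernel.id_apply, Kernel.const_apply,
    Measure.bind_apply hA (Kernel.aemeasurable _), Measure.bind_apply hA (Kernel.aemeasurable _),
    lintegral_prod _ hmA.aemeasurable, lintegral_dirac']
  · rfl
  · exact hmA.lintegral_prod_right'

lemma integral_sq_sum_signalLaw_le (K : Kernel (Θ × E) E) [IsMarkovKernel K] (θ : Θ)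
    {ψ : E → ℝ} (hψ : Measurable ψ) {C D : ℝ} (hC : ∀ x, |ψ x| ≤ C)
    (hD : ∀ n x, |∑ k ∈ Finset.range n, (act (K.sectR θ))^[k + 1] ψ x| ≤ D)
    (μ : Measure E) [IsProbabilityMeasure μ] (n : ℕ) :
    ∫ z, (∑ k, ψ (z k)) ^ 2 ∂(signalLaw K μ n θ) ≤ n * (C ^ 2 + 2 * C * D) := by
  rw [signalLaw_apply, integral_bind]
  · refine (integral_mono_of_nonneg (.of_forall fun x₁ => integral_nonneg fun z => sq_nonneg _)
      (integrable_const _)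
      (.of_forall fun x => integral_sq_sum_signalFrom_le K θ hψ hC hD n x)).trans_eq ?_
    simp
  · exact integrable_of_mem_Icc (by fun_prop) fun z => abs_le.1 (abs_sq_sum_le hC z)

end Signal

/-! ### Second moments of the observations. -/

section Noise

variable {E : Type*} [TopologicalSpace E] [FirstCountableTopology E] {d : ℕ}

/-- The conditional expectation of `f (h x + V)` given the signal `x`. -/
noncomputable def smooth (h : E →ᵇ EuclideanSpace ℝ (Fin d)) (σ : ℝ)
    (f : EuclideanSpace ℝ (Fin d) →ᵇ ℝ) : E →ᵇ ℝ :=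
  BoundedContinuousFunction.ofNormedAddCommGroup (fun x => ∫ v, f (h x + v) ∂(noise d σ))
    (by
      refine continuous_of_dominated (F := fun x v => f (h x + v)) (bound := fun _ => ‖f‖)
        (fun x => Continuous.aestronglyMeasurable (by fun_prop))
        (fun x => .of_forall fun v => f.norm_coe_le_norm _) (integrable_const _)
        (.of_forall fun v => by fun_prop)) ‖f‖
    (fun x => by
      simpa using norm_integral_le_of_norm_le_const (μ := noise d σ)
        (f := fun v => f (h x + v)) (.of_forall fun v => f.norm_coe_le_norm _))

lemma smooth_apply (h : E →ᵇ EuclideanSpace ℝ (Fin d)) (σ : ℝ)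
    (f : EuclideanSpace ℝ (Fin d) →ᵇ ℝ) (x : E) :
    smooth h σ f x = ∫ v, f (h x + v) ∂(noise d σ) := rfl

/-- For a fixed signal the summands are independent, with means `smooth h σ f (x k)` and variances
at most `‖f‖²`; the second moment is the variance plus the squared mean. -/
lemma integral_sq_sum_noise_le (h : E →ᵇ EuclideanSpace ℝ (Fin d)) (σ : ℝ)
    (f : EuclideanSpace ℝ (Fin d) →ᵇ ℝ) {n : ℕ} (x : Fin n → E) :
    ∫ v, (∑ k, f (h (x k) + v k)) ^ 2 ∂(Measure.pi fun _ : Fin n => noise d σ) ≤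
      n * ‖f‖ ^ 2 + (∑ k, smooth h σ f (x k)) ^ 2 := by
  set X : Fin n → EuclideanSpace ℝ (Fin d) → ℝ := fun k v => f (h (x k) + v) with hX
  have hXm : ∀ k, Continuous (X k) := fun k => by fun_prop
  have hXb : ∀ k v, X k v ∈ Set.Icc (-‖f‖) ‖f‖ := fun k v => abs_le.1 (f.norm_coe_le_norm _)
  have hXL : ∀ k, MemLp (X k) 2 (noise d σ) := fun k =>
    memLp_of_bounded (.of_forall (hXb k)) (hXm k).aestronglyMeasurable 2
  set P := Measure.pi fun _ : Fin n => noise d σ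
  have hS : MemLp (∑ k, fun v : Fin n → EuclideanSpace ℝ (Fin d) => X k (v k)) 2 P :=
    memLp_finsetSum' _ fun k _ => (hXL k).comp_measurePreserving (measurePreserving_eval _ k)
  have hvar := variance_eq_sub hS
  rw [variance_sum_pi hXL] at hvar
  have hmean : ∫ v, (∑ k, fun v : Fin n → EuclideanSpace ℝ (Fin d) => X k (v k)) v ∂P =
      ∑ k, smooth h σ f (x k) := by
    simp only [Finset.sum_apply]
    rw [integral_finsetSum]
    · refine Finset.sum_congr rfl fun k _ => ?_
      rw [smooth_apply]
      exact integral_comp_eval (hXm k).aestronglyMeasurable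
    · intro k _
      exact integrable_of_mem_Icc ((hXm k).measurable.comp (measurable_pi_apply k))
        fun v => hXb k (v k)
  have hle : ∑ k, variance (X k) (noise d σ) ≤ n * ‖f‖ ^ 2 := by
    refine (Finset.sum_le_sum fun k _ => variance_le_sq_of_bounded (.of_forall (hXb k))
      (hXm k).measurable.aemeasurable).trans_eq ?_
    simp only [Finset.sum_const, Finset.card_univ, Fintype.card_fin, nsmul_eq_mul]
    ring
  rw [hmean] at hvar
  simp only [Pi.pow_apply, Finset.sum_apply] at hvar
  linarith

end Noise

section Observations

variable {Θ E : Type*} [MeasurableSpace Θ] [MeasurableSpace E] [TopologicalSpace E] [PolishSpace E]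
  [BorelSpace E] {d : ℕ}

lemma integral_obsLimit (κ : Kernel E E) [IsFiniteMeasure (limitingDistribution κ)]
    (h : E →ᵇ EuclideanSpace ℝ (Fin d)) (σ : ℝ) (f : EuclideanSpace ℝ (Fin d) →ᵇ ℝ) :
    ∫ y, f y ∂(obsLimit κ h σ) = ∫ x, smooth h σ f x ∂(limitingDistribution κ) := by
  have hh : Measurable h := h.continuous.measurable
  have hm : IsFiniteMeasure ((limitingDistribution κ).map h) := inferInstance
  rw [obsLimit, Measure.conv, integral_map (by fun_prop) f.continuous.aestronglyMeasurable,
    integral_prod, integral_map hh.aemeasurable]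
  · rfl
  · refine (Continuous.stronglyMeasurable ?_).aestronglyMeasurable
    exact continuous_of_dominated (F := fun z v => f (z + v)) (bound := fun _ => ‖f‖)
        (fun x => Continuous.aestronglyMeasurable (by fun_prop))
        (fun x => .of_forall fun v => f.norm_coe_le_norm _) (integrable_const _)
        (.of_forall fun v => by fun_prop)
  · exact integrable_of_mem_Icc (f.continuous.measurable.comp (by fun_prop))
      fun z => abs_le.1 (f.norm_coe_le_norm _)

lemma isProbabilityMeasure_obsLimit [Nonempty E] {κ : Kernel E E} [IsMarkovKernel κ]
    (hκ : IsMixing κ) (h : E →ᵇ EuclideanSpace ℝ (Fin d)) (σ : ℝ) :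
    IsProbabilityMeasure (obsLimit κ h σ) := by
  have := hκ.isLimitingDistribution.1
  have : IsProbabilityMeasure ((limitingDistribution κ).map h) :=
    Measure.isProbabilityMeasure_map h.continuous.measurable.aemeasurable
  unfold obsLimit
  infer_instance

/-- The second moment of sums of centered functions of the observations grows at most linearly. -/
lemma exists_integral_sq_sum_obsLaw_le (K : Kernel (Θ × E) E) [IsMarkovKernel K] {θ : Θ}
    (hθ : IsMixing (K.sectR θ)) (h : E →ᵇ EuclideanSpace ℝ (Fin d)) (σ : ℝ)
    (μ : Measure E) [IsProbabilityMeasure μ] (f : EuclideanSpace ℝ (Fin d) →ᵇ ℝ)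
    (hf : ∫ y, f y ∂(obsLimit (K.sectR θ) h σ) = 0) :
    ∃ D, ∀ n : ℕ, ∫ y, (∑ k, f (y k)) ^ 2 ∂(obsLaw K h σ μ n θ) ≤ n * D := by
  have : Nonempty E := nonempty_of_isProbabilityMeasure μ
  have := hθ.isLimitingDistribution.1
  -- Centering `f` under the limit of the observations is centering its noise average under the
  -- limit of the signal, so the moment bounds for the signal apply.
  rw [integral_obsLimit] at hf
  obtain ⟨D, hD⟩ := hθ.exists_sum_act_le _ hf
  have hC : ∀ x, |smooth h σ f x| ≤ ‖smooth h σ f‖ := (smooth h σ f).norm_coe_le_norm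
  have hsm : Measurable (smooth h σ f) := (smooth h σ f).continuous.measurable
  have hfm : Measurable f := f.continuous.measurable
  have hfC : ∀ y, |f y| ≤ ‖f‖ := f.norm_coe_le_norm
  refine ⟨‖f‖ ^ 2 + (‖smooth h σ f‖ ^ 2 + 2 * ‖smooth h σ f‖ * D), fun n => ?_⟩
  have ho := measurable_observe h n
  have hi : Integrable (fun x : Fin n → E => (∑ k, smooth h σ f (x k)) ^ 2)
      (signalLaw K μ n θ) :=
    integrable_of_mem_Icc (by fun_prop) fun z => abs_le.1 (abs_sq_sum_le hC z)
  rw [obsLaw_apply, integral_map ho.aemeasurable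
    (Measurable.aestronglyMeasurable (by fun_prop)), integral_prod]
  · refine (integral_mono_of_nonneg (.of_forall fun x => integral_nonneg fun z => sq_nonneg _)
      ((integrable_const _).add hi)
      (.of_forall fun x => integral_sq_sum_noise_le h σ f x)).trans ?_
    rw [integral_add' (integrable_const _) hi, mul_add]
    simpa using integral_sq_sum_signalLaw_le K θ hsm hC hD μ n
  · exact integrable_of_mem_Icc (by fun_prop) fun z => abs_le.1 (abs_sq_sum_le hfC _)

end Observations

/-! ### Weak law of large numbers for the empirical measures. -/

section WeakConvergence

variable {Ω : Type*} [TopologicalSpace Ω] [MeasurableSpace Ω] [OpensMeasurableSpace Ω]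
  {X : ℕ → Type*} [∀ n, MeasurableSpace (X n)]

/-- Random probability measures whose integrals of bounded continuous functions converge in
probability to those of `ν` are eventually in any neighborhood of `ν`, with high probability. -/
lemma tendsto_measure_preimage_compl_of_mem_nhds {Q : ∀ n, Measure (X n)}
    {L : ∀ n, X n → ProbabilityMeasure Ω} {ν : ProbabilityMeasure Ω}
    (hL : ∀ (f : Ω →ᵇ ℝ) (δ : ℝ), 0 < δ → Tendsto (fun n => Q n
      {y | δ ≤ |∫ z, f z ∂(L n y : Measure Ω) - ∫ z, f z ∂(ν : Measure Ω)|}) atTop (𝓝 0))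
    {S : Set (ProbabilityMeasure Ω)} (hS : S ∈ 𝓝 ν) :
    Tendsto (fun n => Q n (L n ⁻¹' S)ᶜ) atTop (𝓝 0) := by
  -- The sets hit with probability tending to one form a filter. Convergence of this filter to `ν`
  -- can be tested on one bounded continuous function at a time, with no countable determining
  -- class.
  let F : Filter (ProbabilityMeasure Ω) :=
    { sets := {S | Tendsto (fun n => Q n (L n ⁻¹' S)ᶜ) atTop (𝓝 0)}
      univ_sets := by simp
      sets_of_superset := fun {S S'} hS hSS' =>
        tendsto_of_tendsto_of_tendsto_of_le_of_le tendsto_const_nhds hS (fun _ => zero_le)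
          fun n => measure_mono (Set.compl_subset_compl.2 (Set.preimage_mono hSS'))
      inter_sets := fun {S S'} hS hS' => by
        have hadd : Tendsto (fun n => Q n (L n ⁻¹' S)ᶜ + Q n (L n ⁻¹' S')ᶜ) atTop (𝓝 0) := by
          simpa using Tendsto.add hS hS'
        refine tendsto_of_tendsto_of_tendsto_of_le_of_le tendsto_const_nhds hadd
          (fun _ => zero_le) fun n => ?_
        dsimp only
        rw [Set.preimage_inter, Set.compl_inter]
        exact measure_union_le _ _ }
  have hF : Tendsto id F (𝓝 ν) := by
    refine ProbabilityMeasure.tendsto_iff_forall_integral_tendsto.2 fun f => ?_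
    refine Metric.tendsto_nhds.2 fun δ hδ => ?_
    refine (hL f δ hδ).congr fun n => congrArg (Q n) (Set.ext fun y => ?_)
    rw [Set.mem_compl_iff, Set.mem_preimage, Set.mem_ofPred_eq, Set.mem_ofPred_eq, Real.dist_eq,
      not_lt, id]
  exact hF hS

lemma setOf_levyProkhorovDist_lt_mem_nhds {Ω : Type*} [PseudoMetricSpace Ω]
    [TopologicalSpace.SeparableSpace Ω] [MeasurableSpace Ω] [OpensMeasurableSpace Ω]
    (ν : ProbabilityMeasure Ω) {r : ℝ} (hr : 0 < r) :
    {m : ProbabilityMeasure Ω | levyProkhorovDist (m : Measure Ω) (ν : Measure Ω) < r} ∈ 𝓝 ν :=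
  LevyProkhorov.continuous_ofMeasure_probabilityMeasure.continuousAt.preimage_mem_nhds
    (Metric.ball_mem_nhds (LevyProkhorov.ofMeasure ν) hr)

end WeakConvergence

section Empirical

variable {d : ℕ}

lemma isProbabilityMeasure_empirical {n : ℕ} (y : Fin (n + 1) → EuclideanSpace ℝ (Fin d)) :
    IsProbabilityMeasure (empirical y) := by
  refine ⟨?_⟩
  simp only [empirical, Measure.smul_apply, Measure.finsetSum_apply, measure_univ, smul_eq_mul,
    Finset.sum_const, Finset.card_univ, Fintype.card_fin, nsmul_eq_mul, mul_one]
  exact ENNReal.inv_mul_cancel (by simp) (ENNReal.natCast_ne_top _)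

lemma integral_empirical {n : ℕ} (y : Fin n → EuclideanSpace ℝ (Fin d))
    (f : EuclideanSpace ℝ (Fin d) →ᵇ ℝ) :
    ∫ z, f z ∂(empirical y) = (n : ℝ)⁻¹ * ∑ k, f (y k) := by
  rw [empirical, integral_smul_measure, integral_finsetSum_measure]
  · simp
  · exact fun k _ => f.integrable _

variable {Θ E : Type*} [MeasurableSpace Θ] [MeasurableSpace E] [TopologicalSpace E] [PolishSpace E]
  [BorelSpace E]

/-- The weak law of large numbers for bounded continuous functions of the observations. -/
lemma tendsto_measure_integral_empirical (K : Kernel (Θ × E) E) [IsMarkovKernel K] {θ : Θ}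
    (hθ : IsMixing (K.sectR θ)) (h : E →ᵇ EuclideanSpace ℝ (Fin d)) (σ : ℝ)
    (μ : Measure E) [IsProbabilityMeasure μ] (f : EuclideanSpace ℝ (Fin d) →ᵇ ℝ)
    {δ : ℝ} (hδ : 0 < δ) :
    Tendsto (fun n : ℕ => obsLaw K h σ μ (n + 1) θ
      {y | δ ≤ |∫ z, f z ∂(empirical y) - ∫ z, f z ∂(obsLimit (K.sectR θ) h σ)|}) atTop
      (𝓝 0) := by
  have : Nonempty E := nonempty_of_isProbabilityMeasure μ
  have := isProbabilityMeasure_obsLimit hθ h σ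
  set c := ∫ z, f z ∂(obsLimit (K.sectR θ) h σ) with hc
  set g : EuclideanSpace ℝ (Fin d) →ᵇ ℝ := f - BoundedContinuousFunction.const _ c with hg
  have hgf : ∀ z, g z = f z - c := fun z => rfl
  obtain ⟨D, hD⟩ := exists_integral_sq_sum_obsLaw_le K hθ h σ μ g (by
    simp_rw [hgf]
    rw [integral_sub (f.integrable _) (integrable_const _)]
    simp [hc])
  have hlim : Tendsto (fun n : ℕ => ENNReal.ofReal (D / δ ^ 2 * (1 / ((n : ℝ) + 1)))) atTop
      (𝓝 0) := by
    have := ENNReal.tendsto_ofReal ((tendsto_one_div_add_atTop_nhds_zero_nat (𝕜 := ℝ)).const_mul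
      (D / δ ^ 2))
    simpa using this
  refine tendsto_of_tendsto_of_tendsto_of_le_of_le tendsto_const_nhds hlim (fun _ => zero_le)
    fun n => ?_
  have hn : (0 : ℝ) < n + 1 := by positivity
  have hgm : Measurable g := g.continuous.measurable
  have hmarkov := mul_meas_ge_le_integral_of_nonneg (μ := obsLaw K h σ μ (n + 1) θ)
    (f := fun y => (∑ k, g (y k)) ^ 2) (.of_forall fun y => sq_nonneg _)
    (integrable_of_mem_Icc (by fun_prop) fun z => abs_le.1 (abs_sq_sum_le g.norm_coe_le_norm z))
    ((δ * (n + 1)) ^ 2)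
  have hreal : (obsLaw K h σ μ (n + 1) θ).real {y | (δ * (n + 1)) ^ 2 ≤ (∑ k, g (y k)) ^ 2} ≤
      D / δ ^ 2 * (1 / ((n : ℝ) + 1)) := by
    have hp : 0 < (δ * ((n : ℝ) + 1)) ^ 2 := by positivity
    have h1 := (le_div_iff₀' hp).2 (hmarkov.trans (hD (n + 1)))
    refine h1.trans_eq ?_
    push_cast
    field_simp
  refine le_trans (measure_mono fun y hy => ?_) ((ENNReal.le_ofReal_iff_toReal_le
    (measure_ne_top _ _) (measureReal_nonneg.trans hreal)).2 hreal)
  have hsum : ∑ k, g (y k) = (n + 1) * (∫ z, f z ∂(empirical y) - c) := by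
    simp_rw [hgf, integral_empirical, Finset.sum_sub_distrib]
    simp only [Finset.sum_const, Finset.card_univ, Fintype.card_fin, nsmul_eq_mul]
    push_cast
    field_simp
  rw [Set.mem_ofPred_eq, hsum, ← sq_abs (((n : ℝ) + 1) * _), abs_mul, abs_of_pos hn]
  refine pow_le_pow_left₀ (by positivity) ?_ 2
  rw [mul_comm]
  exact mul_le_mul_of_nonneg_left hy hn.le

/-- The weak law of large numbers for the empirical measures of the observations, in the
Lévy-Prokhorov metric. -/
lemma tendsto_measure_levyProkhorovDist (K : Kernel (Θ × E) E) [IsMarkovKernel K] {θ : Θ}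
    (hθ : IsMixing (K.sectR θ)) (h : E →ᵇ EuclideanSpace ℝ (Fin d)) (σ : ℝ)
    (μ : Measure E) [IsProbabilityMeasure μ] {r : ℝ} (hr : 0 < r) :
    Tendsto (fun n : ℕ => obsLaw K h σ μ n θ
      {y | levyProkhorovDist (empirical y) (obsLimit (K.sectR θ) h σ) < r}ᶜ) atTop (𝓝 0) := by
  have : Nonempty E := nonempty_of_isProbabilityMeasure μ
  -- For `n = 0` the empirical measure is zero, not a probability measure.
  rw [← tendsto_add_atTop_iff_nat 1]
  let ν : ProbabilityMeasure (EuclideanSpace ℝ (Fin d)) :=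
    ⟨obsLimit (K.sectR θ) h σ, isProbabilityMeasure_obsLimit hθ h σ⟩
  let L : ∀ n, (Fin (n + 1) → EuclideanSpace ℝ (Fin d)) →
      ProbabilityMeasure (EuclideanSpace ℝ (Fin d)) :=
    fun n y => ⟨empirical y, isProbabilityMeasure_empirical y⟩
  have hL : ∀ (f : EuclideanSpace ℝ (Fin d) →ᵇ ℝ) (δ : ℝ), 0 < δ →
      Tendsto (fun n => obsLaw K h σ μ (n + 1) θ {y | δ ≤ |∫ z, f z ∂(L n y : Measure _) -
        ∫ z, f z ∂(ν : Measure _)|}) atTop (𝓝 0) :=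
    fun f δ hδ => tendsto_measure_integral_empirical K hθ h σ μ f hδ
  have hS := setOf_levyProkhorovDist_lt_mem_nhds ν hr
  exact tendsto_measure_preimage_compl_of_mem_nhds hL hS

end Empirical

/-! ### Exponential rates and the conclusion. -/

section Asymptotics

lemma le_ofReal_exp_of_log_le {n : ℕ} (hn : n ≠ 0) {b : ℝ≥0∞} {J : ℝ}
    (h : (1 / (n : EReal)) * ENNReal.log b < ((-J : ℝ) : EReal)) :
    b ≤ ENNReal.ofReal (Real.exp (-(n * J))) := by
  by_contra! hlt
  have hn0 : (0 : ℝ) < n := by positivity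
  have h1 : ((-(n * J) : ℝ) : EReal) ≤ ENNReal.log b := by
    have := ENNReal.log_monotone hlt.le
    rwa [ENNReal.log_ofReal_of_pos (Real.exp_pos _), Real.log_exp] at this
  have h2 : (1 / (n : EReal)) = ((1 / n : ℝ) : EReal) := by
    rw [EReal.coe_div]; simp
  rw [h2] at h
  have h3 := (mul_le_mul_of_nonneg_left h1
    (EReal.coe_nonneg.2 (one_div_nonneg.2 hn0.le))).trans_lt h
  rw [← EReal.coe_mul, EReal.coe_lt_coe_iff] at h3
  refine h3.ne ?_
  field_simp

lemma tendsto_ofReal_exp_neg {f : ℕ → ℝ} (hf : Tendsto f atTop atTop) :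
    Tendsto (fun n => ENNReal.ofReal (Real.exp (-f n))) atTop (𝓝 0) := by
  simpa using ENNReal.tendsto_ofReal (Real.tendsto_exp_neg_atTop_nhds_zero.comp hf)

lemma tendsto_natCast_div_atTop {p : ℕ → ℝ} (hp_one : ∀ n, 1 ≤ p n)
    (hp : Tendsto (fun n : ℕ => p n / n) atTop (𝓝 0)) :
    Tendsto (fun n : ℕ => (n : ℝ) / p n) atTop atTop := by
  have h : Tendsto (fun n : ℕ => p n / n) atTop (𝓝[>] 0) := by
    refine tendsto_nhdsWithin_iff.2 ⟨hp, eventually_atTop.2 ⟨1, fun n hn => ?_⟩⟩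
    have : (0 : ℝ) < n := by exact_mod_cast hn
    exact div_pos (zero_lt_one.trans_le (hp_one n)) this
  exact h.inv_tendsto_nhdsGT_zero.congr fun n => inv_div _ _

end Asymptotics

end HMM

theorem mainTheorem3 {E Θ : Type*}
    [TopologicalSpace E] [PolishSpace E] [MeasurableSpace E] [BorelSpace E]
    [MetricSpace Θ] [PolishSpace Θ] [MeasurableSpace Θ] [BorelSpace Θ] [Nonempty Θ]
    (K : Kernel (Θ × E) E) [IsMarkovKernel K]
    (hFeller : ∀ θ, HMM.IsFeller (K.sectR θ)) (hMixing : ∀ θ, HMM.IsMixing (K.sectR θ))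
    (d : ℕ) (h : E →ᵇ EuclideanSpace ℝ (Fin d)) (σ : ℝ) (hσ : 0 < σ)
    (μ μ' : Measure E) [IsProbabilityMeasure μ] [IsProbabilityMeasure μ']
    (u : Measure Θ) [IsProbabilityMeasure u] (α : Θ)
    -- a jointly measurable version of the Radon-Nikodym derivatives of the observation laws
    (ρ : (n : ℕ) → Θ → (Fin n → EuclideanSpace ℝ (Fin d)) → ℝ≥0∞)
    (hρ_meas : ∀ n, Measurable (Function.uncurry (ρ n)))
    (hρ : ∀ n θ, ρ n θ =ᵐ[HMM.obsLaw K h σ μ' n θ]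
      (HMM.obsLaw K h σ μ n α).rnDeriv (HMM.obsLaw K h σ μ' n θ))
    -- the condition on the prior mass near the true value
    (ε : ℕ → ℝ) (hε_pos : ∀ n, 0 < ε n) (hε_anti : Antitone ε) (hε : Tendsto ε atTop (𝓝 0))
    (p : ℕ → ℝ) (hp_one : ∀ n, 1 ≤ p n) (hp : Tendsto (fun n : ℕ => p n / n) atTop (𝓝 0))
    (hprior : limsup (fun n : ℕ =>
        ∫⁻ y, ((⨆ θ ∈ ball α (ε n), ρ n θ y) / u (ball α (ε n))) ^ (1 / p n)
          ∂(HMM.obsLaw K h σ μ n α)) atTop < ⊤)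
    -- the exponential bound away from the true value
    (hLD : ∀ η : ℝ, 0 < η → ∃ r : ℝ, 0 < r ∧ ∃ I : ℝ, 0 < I ∧
      limsup (fun n : ℕ => (1 / (n : EReal)) * ENNReal.log
        (∫⁻ θ in (ball α η)ᶜ, HMM.obsLaw K h σ μ' n θ
          {y | levyProkhorovDist (HMM.empirical y) (HMM.obsLimit (K.sectR α) h σ) < r} ∂u)) atTop
        ≤ ((-I : ℝ) : EReal)) :
    ∀ η : ℝ, 0 < η → Tendsto (fun n : ℕ =>
      ∫⁻ y, HMM.thetaPosterior K h σ μ' u n y (ball α η)ᶜ ∂(HMM.obsLaw K h σ μ n α))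
      atTop (𝓝 0) := by
  intro η hη
  obtain ⟨r, hr, I, hI, hlimsup⟩ := hLD η hη
  obtain ⟨C, hC, hCtop⟩ := exists_between hprior
  have hCev := eventually_lt_of_limsup_lt hC
  set A : ∀ n, Set (Fin n → EuclideanSpace ℝ (Fin d)) := fun n =>
    {y | levyProkhorovDist (HMM.empirical y) (HMM.obsLimit (K.sectR α) h σ) < r} with hA
  -- A measurable subset of `A n` whose complement has the same probability under the true law; this
  -- avoids proving `A n` measurable.
  set G : ∀ n, Set (Fin n → EuclideanSpace ℝ (Fin d)) := fun n =>
    (toMeasurable (HMM.obsLaw K h σ μ n α) (A n)ᶜ)ᶜ with hG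
  have hGA : ∀ n, G n ⊆ A n := fun n => Set.compl_subset_comm.1 (subset_toMeasurable _ _)
  -- The rate `I / 4` makes `t n * t n` equal to the eventual bound `exp(-nI/2)`, so the last term
  -- is at most `t n`.
  set t : ℕ → ℝ≥0∞ := fun n => ENNReal.ofReal (Real.exp (-(n * (I / 4)))) with ht
  have hdiv : Tendsto (fun n : ℕ => (n : ℝ) * (I / 4)) atTop atTop :=
    tendsto_natCast_atTop_atTop.atTop_mul_const (by positivity)
  have hGlim : Tendsto (fun n => HMM.obsLaw K h σ μ n α (G n)ᶜ) atTop (𝓝 0) := by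
    refine (HMM.tendsto_measure_levyProkhorovDist K (hMixing α) h σ μ hr).congr fun n => ?_
    rw [hG, compl_compl, measure_toMeasurable]
  have hplim : Tendsto (fun n => t n ^ (1 / p n) * C) atTop (𝓝 0) := by
    have h1 : Tendsto (fun n => ENNReal.ofReal (Real.exp (-(n / p n * (I / 4))))) atTop (𝓝 0) :=
      HMM.tendsto_ofReal_exp_neg
        ((HMM.tendsto_natCast_div_atTop hp_one hp).atTop_mul_const (by positivity))
    have h2 := ENNReal.Tendsto.mul_const (b := C) h1 (.inr hCtop.ne)
    rw [zero_mul] at h2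
    refine h2.congr fun n => ?_
    have hpn : 0 < p n := zero_lt_one.trans_le (hp_one n)
    rw [ENNReal.ofReal_rpow_of_pos (Real.exp_pos _), ← Real.exp_mul]
    congr 3
    field_simp
  have hlim : Tendsto (fun n => HMM.obsLaw K h σ μ n α (G n)ᶜ + t n ^ (1 / p n) * C + t n) atTop
      (𝓝 0) := by
    simpa using (hGlim.add hplim).add (HMM.tendsto_ofReal_exp_neg hdiv)
  -- A limsup of at most `-I` yields an eventual bound only at a strictly larger level, here `-I/2`.
  have hIev := eventually_lt_of_limsup_lt (hlimsup.trans_lt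
    (EReal.coe_lt_coe_iff.2 (show -I < -(I / 2) by linarith)))
  refine tendsto_of_tendsto_of_tendsto_of_le_of_le' tendsto_const_nhds hlim
    (.of_forall fun _ => zero_le) ?_
  filter_upwards [hCev, hIev, eventually_ne_atTop 0] with n hCn hIn hn
  have hac : ∀ θ, HMM.obsLaw K h σ μ n α ≪ HMM.obsLaw K h σ μ' n θ := fun θ =>
    HMM.obsLaw_absolutelyContinuous K h hσ.ne' μ μ' n α θ
  have ht0 : t n ≠ 0 := by simpa [ht] using Real.exp_pos _
  have htop : t n ≠ ⊤ := ENNReal.ofReal_ne_top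
  have hp0 : 0 < 1 / p n := one_div_pos.2 (zero_lt_one.trans_le (hp_one n))
  refine (HMM.lintegral_posterior_le (N := ball α (ε n)) (G := G n) (hρ_meas n) hac (hρ n)
    (measurableSet_toMeasurable _ _).compl measurableSet_ball.compl ht0 htop).trans ?_
  refine add_le_add (add_le_add le_rfl ?_) ?_
  · exact (HMM.measure_invLikelihood_lt_le (hρ_meas n) hac (hρ n) measurableSet_ball
      (mem_ball_self (hε_pos n)) ht0 htop hp0).trans (mul_le_mul' le_rfl hCn.le)
  · have hb : ∫⁻ θ in (ball α η)ᶜ, HMM.obsLaw K h σ μ' n θ (G n) ∂u ≤ t n * t n := by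
      refine (lintegral_mono fun θ => measure_mono (hGA n)).trans
        ((HMM.le_ofReal_exp_of_log_le hn hIn).trans_eq ?_)
      rw [ht, ← ENNReal.ofReal_mul (Real.exp_pos _).le, ← Real.exp_add]
      congr 2
      ring
    refine (mul_le_mul' le_rfl hb).trans_eq ?_
    rw [← mul_assoc, ENNReal.inv_mul_cancel ht0 htop, one_mul]
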